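/- Let $\mathbf k$ be a commutative ring with unit of characteristic zero, let $\lambda\in\mathbf k$, and let $(X,\le)$ be a well-ordered set. Let $\mathfrak S(X)$ be the set of nonempty bracketed words on $X$, i.e. the free semigroup with a unary operation $w\mapsto\lfloor w\rfloor$ generated by $X$; every $w\in\mathfrak S(X)$ is uniquely $w=w_1\cdots w_n$ with $n\ge 1$ and $w_i\in X\cup\lfloor\mathfrak S(X)\rfloor$ (its prime factors; $|w|:=n$). Let $\mathbf k\mathfrak S(X)$ be the free $\mathbf k$-module on $\mathfrak S(X)$, with multiplication and bracket extended linearly. Let $\mathfrak S^\star(X)$ be the set of bracketed words on $X\sqcup\{\star\}$ with exactly one occurrence of $\star$; for $q\in\mathfrak S^\star(X)$, $q|_u$ is obtained by replacing $\star$ by $u\in\mathfrak S(X)$, and $q|_s$ for $s\in\mathbf k\mathfrak S(X)$ is defined by linearity. To each occurrence of a letter of $X$ in $w\in\mathfrak S(X)$ attach a path, a word in the alphabet $X\sqcup\{P,\mu\}$: the path of $x$ in $w=x$ is $x$; a path in $\lfloor w\rfloor$ is $P$ followed by the path in $w$; a path in $w_1\cdots w_n$ ($n\ge2$, $w_i$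 prime) is a single $\mu$ followed by the path in the relevant $w_i$. Let $\deg_X(w)$ be the number of occurrences of letters of $X$ in $w$, and let $\mathrm{path}_r(w)$ be the sequence of the paths of these occurrences, taken from right to left. Put $u\le_{\mathrm{PL}_r}v$ if $(\deg_X(u),\mathrm{path}_r(u))\le(\deg_X(v),\mathrm{path}_r(v))$ lexicographically, where paths are compared in the degree lexicographical order with $x<P<\mu$ for all $x\in X$. This is a total preorder; write $u<_{\mathrm{PL}_r}v$ for its strict part. The leading monomial $\overline f$ of $f\in\mathbf k\mathfrak S(X)$ is the monomial occurring in $f$ that is strictly larger than all other monomials occurring in $f$, if there is one; $f$ is monic if $\overline f$ exists and has coefficient $1$. For monic $f,g$: if $w=\overline f u=v\overline g$ with $u,v\in\mathfrak S(X)$ and $\max\{|\overline f|,|\overline g|\}<|w|<|\overline f|+|\overline g|$, then $fu-vg$ is an intersection composition with respect to $w$; if $w=\overline f=q|_{\overline g}$ with $q\in\mathfrak S^\star(X)$, then $f-q|_g$ is an including composition with respect to $w$. A monic set $S$ is a Gröbner–Shirshov basis if for all $f,g\in S$ every such composition is a linear combination of elements $q|_s$ with $q\in\mathfrak S^\star(X)$,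 $s\in S$, each having a leading monomial $\overline{q|_s}<_{\mathrm{PL}_r}w$. **Theorem.** Let $$S_{\mathrm{rbr}}=\big\{f(x,y):=\lfloor x\lfloor y\rfloor\rfloor+\lfloor\lfloor x\rfloor y\rfloor+\lambda\lfloor xy\rfloor-\lfloor x\rfloor\lfloor y\rfloor \;\big|\; x,y\in\mathfrak S(X)\big\}.$$ 1. The strict part $<_{\mathrm{PL}_r}$ is well-founded. With respect to $\le_{\mathrm{PL}_r}$, $\overline{f(x,y)}=\lfloor x\lfloor y\rfloor\rfloor$ and, more generally, $\overline{q|_{f(x,y)}}=q|_{\lfloor x\lfloor y\rfloor\rfloor}$ for all $q\in\mathfrak S^\star(X)$ and $x,y\in\mathfrak S(X)$; and $S_{\mathrm{rbr}}$ is a Gröbner–Shirshov basis in $\mathbf k\mathfrak S(X)$. 2. Let $\mathrm{Id}(S_{\mathrm{rbr}})$ be the smallest $\mathbf k$-submodule of $\mathbf k\mathfrak S(X)$ that contains $S_{\mathrm{rbr}}$, is a two-sided ideal and is closed under the bracket. Then $\mathbf k\mathfrak S(X)/\mathrm{Id}(S_{\mathrm{rbr}})$, with the operator induced by the bracket and the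 map induced by $X\subset\mathfrak S(X)$, is the free nonunitary Rota–Baxter algebra of weight $\lambda$ on $X$, i.e. free among the associative, not necessarily unitary, $\mathbf k$-algebras with a linear operator $P$ satisfying $P(a)P(b)=P(P(a)b)+P(aP(b))+\lambda P(ab)$. The images of the elements of $$\mathrm{Irr}(S_{\mathrm{rbr}})=\mathfrak S(X)\setminus\{q|_{\lfloor x\lfloor y\rfloor\rfloor}\mid x,y\in\mathfrak S(X),\ q\in\mathfrak S^\star(X)\}$$ form a $\mathbf k$-basis of it. -/

import Mathlib

universe u v w

namespace OperatedGS

/-! ### Bracketed words without the empty word -/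

/-- The prime bracketed words on `X`, that is, the elements of `X ⊔ ⌊𝔖(X)⌋`: a letter `x`, or a
bracket `⌊w⌋` of a nonempty bracketed word `w`. Being inductive, this type is the union of the
usual stages `𝔖₀(X) ⊆ 𝔖₁(X) ⊆ ⋯`. -/
inductive PrimeWord (X : Type*) where
  | var : X → PrimeWord X
  | bracket : FreeSemigroup (PrimeWord X) → PrimeWord X

/-- `𝔖(X)`: nonempty bracketed words, the free semigroup on the prime bracketed words. -/
abbrev Word (X : Type*) := FreeSemigroup (PrimeWord X)

/-- The letter `x` as a bracketed word. -/
def letter {X : Type*} (x : X) : Word X := FreeSemigroup.of (PrimeWord.var x)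

/-- The bracket `w ↦ ⌊w⌋` on `𝔖(X)`. -/
def br {X : Type*} (w : Word X) : Word X := FreeSemigroup.of (PrimeWord.bracket w)

/-- The breadth of a bracketed word: its number of prime factors. -/
def breadth {X : Type*} (w : Word X) : ℕ := FreeSemigroup.length w

/-! ### Words with one star -/

section Star
variable {X : Type*}

/- `none : Option X` is the star `⋆`. -/
mutual
/-- The number of occurrences of `⋆` in a prime bracketed word. -/
def starsPrime : PrimeWord (Option X) → ℕ
  | PrimeWord.var none => 1
  | PrimeWord.var (some _) => 0
  | PrimeWord.bracket w => stars w
/-- The number of occurrences of `⋆` in a bracketed word. -/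
def stars : Word (Option X) → ℕ
  | ⟨a, l⟩ => starsPrime a + starsList l
/-- The number of occurrences of `⋆` in a list of prime bracketed words. -/
def starsList : List (PrimeWord (Option X)) → ℕ
  | [] => 0
  | a :: l => starsPrime a + starsList l
end

mutual
/-- Replace `⋆` by `u` in a prime bracketed word. -/
def plugPrime (u : Word X) : PrimeWord (Option X) → Word X
  | PrimeWord.var none => u
  | PrimeWord.var (some x) => letter x
  | PrimeWord.bracket w => br (plugWord u w)
/-- Replace `⋆` by `u` in a bracketed word (and concatenate the results). -/
def plugWord (u : Word X) : Word (Option X) → Word X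
  | ⟨a, l⟩ => ⟨(plugPrime u a).head, (plugPrime u a).tail ++ plugList u l⟩
/-- Replace `⋆` by `u` in a list of prime bracketed words (and concatenate the results). -/
def plugList (u : Word X) : List (PrimeWord (Option X)) → List (PrimeWord X)
  | [] => []
  | a :: l => (plugPrime u a).head :: ((plugPrime u a).tail ++ plugList u l)
end

end Star

/-- `𝔖^⋆(X)`: bracketed words on `X ⊔ {⋆}` with exactly one occurrence of `⋆`. -/
def StarWord (X : Type*) := {q : Word (Option X) // stars q = 1}

/-- `q|_u`, the result of replacing `⋆` by `u` in `q`. -/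
def StarWord.plug {X : Type*} (q : StarWord X) (u : Word X) : Word X := plugWord u q.1

/-! ### The order by degree and right path sequence -/

section Order
variable {X : Type*}

/-- The alphabet `X ⊔ {P, μ}`, linearly ordered by `x < P < μ` for all `x ∈ X`. -/
abbrev PathLetter (X : Type*) := WithTop (WithTop X)

/-- The symbol of the multiplication. -/
def PathLetter.mu : PathLetter X := ⊤

/-- The symbol of the bracket. -/
def PathLetter.P : PathLetter X := ((⊤ : WithTop X) : WithTop (WithTop X))

/-- A letter of `X` in the path alphabet. -/
def PathLetter.ofVar (x : X) : PathLetter X := ((x : WithTop X) : WithTop (WithTop X))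

mutual
/-- Paths of the letters (from left to right) of a prime bracketed word. -/
def pathsPrime : PrimeWord X → List (List (PathLetter X))
  | PrimeWord.var x => [[PathLetter.ofVar x]]
  | PrimeWord.bracket w => (paths w).map (fun p => PathLetter.P :: p)
/-- Paths of the letters (from left to right) of a bracketed word `w = w₁ ⋯ wₙ`, `wᵢ` prime:
a letter of `wᵢ` has the path that it has in `wᵢ`, preceded by one `μ` if `n ≥ 2`. -/
def paths : Word X → List (List (PathLetter X))
  | ⟨a, []⟩ => pathsPrime a
  | ⟨a, b :: l⟩ => (pathsPrime a ++ pathsList (b :: l)).map (fun p => PathLetter.mu :: p)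
/-- Concatenation of the path sequences of a list of prime bracketed words. -/
def pathsList : List (PrimeWord X) → List (List (PathLetter X))
  | [] => []
  | a :: l => pathsPrime a ++ pathsList l
end

mutual
/-- Number of occurrences of letters of `X` in a prime bracketed word. -/
def degPrime : PrimeWord X → ℕ
  | PrimeWord.var _ => 1
  | PrimeWord.bracket w => deg w
/-- Number of occurrences of letters of `X` in a bracketed word. -/
def deg : Word X → ℕ
  | ⟨a, l⟩ => degPrime a + degList l
/-- Number of occurrences of letters of `X` in a list of prime bracketed words. -/
def degList : List (PrimeWord X) → ℕ
  | [] => 0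
  | a :: l => degPrime a + degList l
end

/-- A word together with its length; compared lexicographically, these pairs give the degree
lexicographical order on words. -/
def dlexKey {L : Type*} (p : List L) : ℕ ×ₗ List L := toLex (p.length, p)

/-- The right path sequence of `w` (paths of the letters from right to left), each path prepared
for comparison in the degree lexicographical order. -/
def pathsRight (w : Word X) : List (ℕ ×ₗ List (PathLetter X)) := (paths w).reverse.map dlexKey

/-- The pair of the degree and the right path sequence, for lexicographic comparison. -/
def plrKey (w : Word X) : ℕ ×ₗ List (ℕ ×ₗ List (PathLetter X)) := toLex (deg w, pathsRight w)

/-- `u ≤_{PL_r} v`: the pair (degree, right path sequence) of `u` is lexicographically at most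
that of `v`. -/
def plr [LinearOrder X] (u v : Word X) : Prop := plrKey u ≤ plrKey v

end Order

/-- The strict part of a relation `≤`. -/
def Strict {W : Type*} (le : W → W → Prop) (u v : W) : Prop := le u v ∧ ¬ le v u

/-! ### The operated algebra of bracketed words and Gröbner–Shirshov bases -/

section Algebra
variable (k : Type*) [CommRing k] {X : Type*}

/-- `k𝔖(X)`: the free `k`-module on `𝔖(X)`, with multiplication extended bilinearly. -/
abbrev WordAlg (k : Type*) [CommRing k] (X : Type*) := MonoidAlgebra k (Word X)

/-- A bracketed word as an element of `k𝔖(X)`. -/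
noncomputable def mono (w : Word X) : WordAlg k X := MonoidAlgebra.single w 1

variable {k}

/-- The `k`-linear extension of a map on bracketed words. -/
noncomputable def linExt (φ : Word X → Word X) : WordAlg k X →ₗ[k] WordAlg k X where
  toFun := MonoidAlgebra.mapDomain φ
  map_add' := MonoidAlgebra.mapDomain_add φ
  map_smul' c x := by
    ext; simp [MonoidAlgebra.mapDomain, Finsupp.mapDomain_smul]

variable (k X) in
/-- The operator on `k𝔖(X)` extending `w ↦ ⌊w⌋` linearly. -/
noncomputable def brAlg : WordAlg k X →ₗ[k] WordAlg k X := linExt br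

/-- `q|_s` for `s ∈ k𝔖(X)`: the linear extension of `u ↦ q|_u`. -/
noncomputable def StarWord.plugAlg (q : StarWord X) : WordAlg k X →ₗ[k] WordAlg k X :=
  linExt q.plug

/-- `m` is the leading monomial of `f` with respect to `le`: it occurs in `f`, and every other
monomial of `f` is strictly smaller. -/
def IsLeading (le : Word X → Word X → Prop) (f : WordAlg k X) (m : Word X) : Prop :=
  m ∈ f.coeff.support ∧ ∀ u ∈ f.coeff.support, u ≠ m → Strict le u m

/-- `S` is monic: every element of `S` has a leading monomial, with coefficient `1`. -/
def IsMonic (le : Word X → Word X → Prop) (S : Set (WordAlg k X)) : Prop :=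
  ∀ s ∈ S, ∃ m, IsLeading le s m ∧ s.coeff m = 1

/-- `f` is trivial modulo `(S, w)`: it is a linear combination of elements `q|_s` with
`q ∈ 𝔖^⋆(X)`, `s ∈ S`, each having a leading monomial strictly smaller than `w`. -/
def IsTrivialMod (le : Word X → Word X → Prop) (S : Set (WordAlg k X)) (w : Word X)
    (f : WordAlg k X) : Prop :=
  f ∈ Submodule.span k {t : WordAlg k X | ∃ q : StarWord X, ∃ s ∈ S,
    t = q.plugAlg s ∧ ∃ m, IsLeading le t m ∧ Strict le m w}

/-- `S` is a Gröbner–Shirshov basis in `k𝔖(X)` with respect to `le`: it is monic and all its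
intersection compositions and including compositions are trivial. -/
structure IsGroebnerShirshov (le : Word X → Word X → Prop) (S : Set (WordAlg k X)) : Prop where
  monic : IsMonic le S
  /-- Intersection compositions: `w = f̄ u = v ḡ` with `max(|f̄|, |ḡ|) < |w| < |f̄| + |ḡ|`. -/
  intersection : ∀ f ∈ S, ∀ g ∈ S, ∀ mf mg u v w : Word X,
    IsLeading le f mf → IsLeading le g mg → w = mf * u → w = v * mg →
    max (breadth mf) (breadth mg) < breadth w → breadth w < breadth mf + breadth mg →
    IsTrivialMod le S w (f * mono k u - mono k v * g)
  /-- Including compositions: `w = f̄ = q|_ḡ`. -/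
  including : ∀ f ∈ S, ∀ g ∈ S, ∀ (mf mg w : Word X) (q : StarWord X),
    IsLeading le f mf → IsLeading le g mg → w = mf → w = q.plug mg →
    IsTrivialMod le S w (f - q.plugAlg g)

end Algebra

/-! ### Operated ideals and their quotients -/

section Quotient
variable {k : Type*} [CommRing k] {A : Type*} [NonUnitalRing A] [Module k A]

/-- A `k`-submodule `I` is an operated ideal of `(A, P)` if it is a two-sided ideal with
`P(I) ⊆ I`. -/
structure IsOperatedIdeal (P : A →ₗ[k] A) (I : Submodule k A) : Prop where
  mul_left : ∀ a, ∀ b ∈ I, a * b ∈ I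
  mul_right : ∀ a ∈ I, ∀ b, a * b ∈ I
  op : ∀ a ∈ I, P a ∈ I

/-- `Id(S)`: the operated ideal generated by `S`. -/
def opIdeal (P : A →ₗ[k] A) (S : Set A) : Submodule k A :=
  sInf {I | S ⊆ I ∧ IsOperatedIdeal P I}

theorem opIdeal_isOperatedIdeal (P : A →ₗ[k] A) (S : Set A) :
    IsOperatedIdeal P (opIdeal P S) where
  mul_left a b hb := by
    simp only [opIdeal, Submodule.mem_sInf] at hb ⊢
    exact fun I hI => hI.2.mul_left a b (hb I hI)
  mul_right a ha b := by
    simp only [opIdeal, Submodule.mem_sInf] at ha ⊢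
    exact fun I hI => hI.2.mul_right a (ha I hI) b
  op a ha := by
    simp only [opIdeal, Submodule.mem_sInf] at ha ⊢
    exact fun I hI => hI.2.op a (ha I hI)

/-- The quotient `A / Id(S)`, as a `k`-module. -/
abbrev OpQuot (P : A →ₗ[k] A) (S : Set A) := A ⧸ opIdeal P S

/-- The canonical projection `A → A / Id(S)`. -/
abbrev OpQuot.mk (P : A →ₗ[k] A) (S : Set A) : A →ₗ[k] OpQuot P S := (opIdeal P S).mkQ

variable (P : A →ₗ[k] A) (S : Set A)

instance OpQuot.instMul : Mul (OpQuot P S) where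
  mul := Quotient.map₂ (· * ·) (by
    intro a a' ha b b' hb
    replace ha := (Submodule.quotientRel_def (opIdeal P S)).1 ha
    replace hb := (Submodule.quotientRel_def (opIdeal P S)).1 hb
    refine (Submodule.quotientRel_def (opIdeal P S)).2 ?_
    have h := opIdeal_isOperatedIdeal P S
    have e : a * b - a' * b' = (a - a') * b + a' * (b - b') := by
      rw [sub_mul, mul_sub]; abel
    rw [e]
    exact add_mem (h.mul_right _ ha _) (h.mul_left _ _ hb))

theorem OpQuot.mk_mul (a b : A) : mk P S (a * b) = mk P S a * mk P S b := rfl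

instance OpQuot.instNonUnitalRing : NonUnitalRing (OpQuot P S) where
  left_distrib a b c := by
    obtain ⟨a, rfl⟩ := (opIdeal P S).mkQ_surjective a
    obtain ⟨b, rfl⟩ := (opIdeal P S).mkQ_surjective b
    obtain ⟨c, rfl⟩ := (opIdeal P S).mkQ_surjective c
    simp only [← map_add, ← OpQuot.mk_mul, mul_add]
  right_distrib a b c := by
    obtain ⟨a, rfl⟩ := (opIdeal P S).mkQ_surjective a
    obtain ⟨b, rfl⟩ := (opIdeal P S).mkQ_surjective b
    obtain ⟨c, rfl⟩ := (opIdeal P S).mkQ_surjective c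
    simp only [← map_add, ← OpQuot.mk_mul, add_mul]
  zero_mul a := by
    obtain ⟨a, rfl⟩ := (opIdeal P S).mkQ_surjective a
    rw [← map_zero (mk P S), ← OpQuot.mk_mul, zero_mul]
  mul_zero a := by
    obtain ⟨a, rfl⟩ := (opIdeal P S).mkQ_surjective a
    rw [← map_zero (mk P S), ← OpQuot.mk_mul, mul_zero]
  mul_assoc a b c := by
    obtain ⟨a, rfl⟩ := (opIdeal P S).mkQ_surjective a
    obtain ⟨b, rfl⟩ := (opIdeal P S).mkQ_surjective b
    obtain ⟨c, rfl⟩ := (opIdeal P S).mkQ_surjective c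
    simp only [← OpQuot.mk_mul, mul_assoc]

instance OpQuot.instIsScalarTower [IsScalarTower k A A] :
    IsScalarTower k (OpQuot P S) (OpQuot P S) where
  smul_assoc r a b := by
    obtain ⟨a, rfl⟩ := (opIdeal P S).mkQ_surjective a
    obtain ⟨b, rfl⟩ := (opIdeal P S).mkQ_surjective b
    simp only [smul_eq_mul, ← map_smul, ← OpQuot.mk_mul, smul_mul_assoc]

instance OpQuot.instSMulCommClass [SMulCommClass k A A] :
    SMulCommClass k (OpQuot P S) (OpQuot P S) where
  smul_comm r a b := by
    obtain ⟨a, rfl⟩ := (opIdeal P S).mkQ_surjective a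
    obtain ⟨b, rfl⟩ := (opIdeal P S).mkQ_surjective b
    simp only [smul_eq_mul, ← map_smul, ← OpQuot.mk_mul, mul_smul_comm]

/-- The operator on `A / Id(S)` induced by `P`. -/
def OpQuot.op : OpQuot P S →ₗ[k] OpQuot P S :=
  (opIdeal P S).mapQ (opIdeal P S) P (fun a ha => (opIdeal_isOperatedIdeal P S).op a ha)

end Quotient

/-! ### Rota–Baxter algebras -/

/-- `P` is a Rota–Baxter operator of weight `c` on the (nonunitary associative) algebra `A`. -/
def IsRotaBaxter {k A : Type*} [CommRing k] [NonUnitalRing A] [Module k A]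
    (c : k) (P : A →ₗ[k] A) : Prop :=
  ∀ x y, P x * P y = P (P x * y) + P (x * P y) + c • P (x * y)

/-- `(F, P)` with `i : X → F` is a free nonunitary Rota–Baxter algebra of weight `c` on `X`
(tested against all algebras in the universe `z`). -/
def IsFreeRotaBaxter.{z, a, b, d} {k : Type a} {X : Type b} {F : Type d} [CommRing k]
    [NonUnitalRing F] [Module k F] [IsScalarTower k F F] [SMulCommClass k F F] (c : k) (P : F →ₗ[k] F) (i : X → F) : Prop :=
  IsRotaBaxter c P ∧
  ∀ (A : Type z) [NonUnitalRing A] [Module k A] [IsScalarTower k A A] [SMulCommClass k A A]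
    (Q : A →ₗ[k] A), IsRotaBaxter c Q → ∀ f : X → A,
      ∃! g : F →ₙₐ[k] A, (∀ y, g (P y) = Q (g y)) ∧ ∀ x, g (i x) = f x

section RB
variable {k : Type*} [CommRing k] {X : Type*}

/-- The Rota–Baxter relation `⌊x⌊y⌋⌋ + ⌊⌊x⌋y⌋ + c⌊xy⌋ - ⌊x⌋⌊y⌋` for `x, y ∈ 𝔖(X)`. -/
noncomputable def rbRel (c : k) (x y : Word X) : WordAlg k X :=
  mono k (br (x * br y)) + mono k (br (br x * y)) + c • mono k (br (x * y))
    - mono k (br x * br y)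

variable (X) in
/-- The set `S_rbr` of all Rota–Baxter relations. -/
def Srbr (c : k) : Set (WordAlg k X) := {f | ∃ x y : Word X, f = rbRel c x y}

variable (X) in
/-- `Irr(S_rbr) = 𝔖(X) \ {q|_{⌊x⌊y⌋⌋}}`. -/
def Irr : Set (Word X) :=
  {w | ∃ (q : StarWord X) (x y : Word X), w = q.plug (br (x * br y))}ᶜ

end RB

end OperatedGS

-- The four monomials of a relation have the same degree, and `⌊x⌊y⌋⌋` gives its last letter a
-- strictly longer path than the other three do. A difference in length at the rightmost differing
-- paths survives every context (`Dominated.context`), which settles all leading monomials.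
-- Reduction along the well-founded order then shows that irreducible words span modulo the ideal,
-- with control on the monomials used (`mono_mem_sup_irrSpan`).
--
-- Linear independence comes from a model instead of from resolving compositions: a Rota–Baxter
-- operator `P = rbOp` is built on the concatenation algebra `k𝔖(X)` itself. If `P(y) = ⌊y⌋`, the
-- Rota–Baxter identity forces `P(a⌊y⌋) = P(a)⌊y⌋ - P(P(a)y) - c P(ay)`. This serves as a recursive
-- definition when `y` is tame, and `P` is the bracket on tame words; tameness is arranged so that
-- the two clauses never overlap. The recursion ends because `P` preserves degree while replacing
-- `⌊y⌋` by `y` shortens the last path. Evaluating words with `P` in place of the bracket kills the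
-- ideal and fixes irreducible words, so the ideal meets their span only in zero
-- (`eq_zero_of_mem_irrSpan_of_mem_opIdeal`).
--
-- The basis follows. So does the Gröbner–Shirshov property: leading monomials have breadth one, so
-- there are no intersection compositions; an including composition lies in the ideal and below `w`,
-- and reducing it leaves an irreducible remainder in the ideal, which is zero. Freeness is the
-- usual evaluation argument.

namespace OperatedGS

/-! ### Structural induction on bracketed words -/

section Words
variable {X : Type*}

/-- Induction on bracketed words along letters, brackets and products. -/
theorem word_induction {C : Word X → Prop} (hletter : ∀ x, C (letter x))
    (hbr : ∀ w, C w → C (br w)) (hmul : ∀ v w, C v → C w → C (v * w)) (w : Word X) : C w := by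
  have key : ∀ (a : PrimeWord X) (l : List (PrimeWord X)), C (FreeSemigroup.of a) →
      (∀ b ∈ l, C (FreeSemigroup.of b)) → C ⟨a, l⟩ := by
    intro a l
    induction l generalizing a with
    | nil => exact fun h _ => h
    | cons b l ih =>
      intro ha hl
      exact hmul (FreeSemigroup.of a) ⟨b, l⟩ ha
        (ih b (hl b (by simp)) fun d hd => hl d (by simp [hd]))
  -- The recursor of the nested inductive type needs three motives: for prime words, for words and
  -- for lists of prime words.
  refine PrimeWord.rec_1 (X := X) (motive_1 := fun a => C (FreeSemigroup.of a)) (motive_2 := C)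
    (motive_3 := fun l => ∀ b ∈ l, C (FreeSemigroup.of b)) hletter hbr key ?_ ?_ w
  · simp
  · intro a l ha hl b hb
    rcases List.mem_cons.1 hb with rfl | hb
    exacts [ha, hl b hb]

/-- The last prime factor of a word is unique. This makes the choice in `rbWord` harmless. -/
theorem mul_br_inj {a a' y y' : Word X} (h : a * br y = a' * br y') : a = a' ∧ y = y' := by
  obtain ⟨a, l⟩ := a
  obtain ⟨a', l'⟩ := a'
  simp only [br, FreeSemigroup.of, FreeSemigroup.mk_mul_mk, FreeSemigroup.mk.injEq] at h
  obtain ⟨rfl, h⟩ := h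
  obtain ⟨rfl, h⟩ := List.append_inj' h rfl
  simpa using h

/-! ### The plugging functions of star words -/

theorem plugWord_mul (u : Word X) (v w : Word (Option X)) :
    plugWord u (v * w) = plugWord u v * plugWord u w := by
  obtain ⟨a, l⟩ := v
  obtain ⟨b, l'⟩ := w
  have h : ∀ l, plugList u (l ++ b :: l') =
      plugList u l ++ (plugPrime u b).head :: ((plugPrime u b).tail ++ plugList u l') := by
    intro l
    induction l with
    | nil => simp [plugList]
    | cons d l ih => simp [plugList, ih]
  simp [plugWord, h, FreeSemigroup.mk_mul_mk]

theorem plugWord_of (u : Word X) (a : PrimeWord (Option X)) :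
    plugWord u (FreeSemigroup.of a) = plugPrime u a := by
  simp [FreeSemigroup.of, plugWord, plugList]

theorem starsList_append (l l' : List (PrimeWord (Option X))) :
    starsList (l ++ l') = starsList l + starsList l' := by
  induction l with
  | nil => simp [starsList]
  | cons a l ih => simp [starsList, ih, add_assoc]

theorem stars_mul (v w : Word (Option X)) : stars (v * w) = stars v + stars w := by
  obtain ⟨a, l⟩ := v
  obtain ⟨b, l'⟩ := w
  simp [stars, starsList_append, starsList, add_assoc]

theorem stars_of (a : PrimeWord (Option X)) : stars (FreeSemigroup.of a) = starsPrime a := by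
  simp [FreeSemigroup.of, stars, starsList]

/-- The functions `u ↦ q|_u`, generated from the identity by brackets and by multiplication with
words on either side. -/
inductive IsContext : (Word X → Word X) → Prop
  | id : IsContext fun u => u
  | br {φ : Word X → Word X} : IsContext φ → IsContext fun u => br (φ u)
  | mul_left {φ : Word X → Word X} (x : Word X) : IsContext φ → IsContext fun u => x * φ u
  | mul_right {φ : Word X → Word X} (x : Word X) : IsContext φ → IsContext fun u => φ u * x

/-- Both cases are needed together: a product with one star has a starless factor, which plugging
leaves constant. -/
theorem isContext_plugWord (q : Word (Option X)) :
    (stars q = 0 → ∃ x, ∀ u, plugWord u q = x) ∧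
      (stars q = 1 → IsContext fun u => plugWord u q) := by
  induction q using word_induction with
  | hletter x =>
    cases x with
    | none =>
      simp only [letter, plugWord_of, plugPrime, stars_of, starsPrime]
      exact ⟨by simp, fun _ => .id⟩
    | some x =>
      simp only [letter, plugWord_of, plugPrime, stars_of, starsPrime]
      exact ⟨fun _ => ⟨_, fun _ => rfl⟩, by simp⟩
  | hbr w ih =>
    simp only [br, plugWord_of, plugPrime, stars_of, starsPrime]
    refine ⟨fun h => ?_, fun h => (ih.2 h).br⟩
    obtain ⟨x, hx⟩ := ih.1 h
    exact ⟨br x, fun u => by rw [hx]; rfl⟩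
  | hmul v w ihv ihw =>
    simp only [plugWord_mul, stars_mul]
    constructor
    · intro h
      obtain ⟨x, hx⟩ := ihv.1 (by lia)
      obtain ⟨y, hy⟩ := ihw.1 (by lia)
      exact ⟨x * y, fun u => by rw [hx, hy]⟩
    · intro h
      obtain ⟨hv, hw⟩ | ⟨hv, hw⟩ : (stars v = 0 ∧ stars w = 1) ∨ (stars v = 1 ∧ stars w = 0) := by
        lia
      · obtain ⟨x, hx⟩ := ihv.1 hv
        simpa only [hx] using (ihw.2 hw).mul_left x
      · obtain ⟨x, hx⟩ := ihw.1 hw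
        simpa only [hx] using (ihv.2 hv).mul_right x

theorem StarWord.isContext (q : StarWord X) : IsContext q.plug :=
  (isContext_plugWord q.1).2 q.2

theorem exists_starless (x : Word X) : ∃ q : Word (Option X), stars q = 0 ∧
    ∀ u, plugWord u q = x := by
  induction x using word_induction with
  | hletter x =>
    exact ⟨letter (some x), by simp [letter, stars_of, starsPrime],
      by simp [letter, plugWord_of, plugPrime]⟩
  | hbr w ih =>
    obtain ⟨q, h0, h⟩ := ih
    exact ⟨br q, by simpa [br, stars_of, starsPrime] using h0,
      fun u => by simp [br, plugWord_of, plugPrime, h]⟩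
  | hmul v w ihv ihw =>
    obtain ⟨p, h0, h⟩ := ihv
    obtain ⟨q, h0', h'⟩ := ihw
    exact ⟨p * q, by simp [stars_mul, h0, h0'], fun u => by simp [plugWord_mul, h, h']⟩

theorem IsContext.exists_starWord {φ : Word X → Word X} (hφ : IsContext φ) :
    ∃ q : StarWord X, q.plug = φ := by
  induction hφ with
  | id =>
    exact ⟨⟨letter none, by simp [letter, stars_of, starsPrime]⟩, by
      funext u; simp [StarWord.plug, letter, plugWord_of, plugPrime]⟩
  | br _ ih =>
    obtain ⟨q, rfl⟩ := ih
    exact ⟨⟨OperatedGS.br q.1, by simpa [OperatedGS.br, stars_of, starsPrime] using q.2⟩, by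
      funext u; simp [StarWord.plug, OperatedGS.br, plugWord_of, plugPrime]⟩
  | mul_left x _ ih =>
    obtain ⟨q, rfl⟩ := ih
    obtain ⟨p, h0, h⟩ := exists_starless x
    exact ⟨⟨p * q.1, by simp [stars_mul, h0, q.2]⟩, by
      funext u; simp [StarWord.plug, plugWord_mul, h]⟩
  | mul_right x _ ih =>
    obtain ⟨q, rfl⟩ := ih
    obtain ⟨p, h0, h⟩ := exists_starless x
    exact ⟨⟨q.1 * p, by simp [stars_mul, h0, q.2]⟩, by
      funext u; simp [StarWord.plug, plugWord_mul, h]⟩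

/-! ### Irreducible words -/

theorem not_mem_Irr_iff {w : Word X} :
    w ∉ Irr X ↔ ∃ φ, IsContext φ ∧ ∃ x y : Word X, w = φ (br (x * br y)) := by
  simp only [Irr, Set.mem_compl_iff, not_not, Set.mem_ofPred_eq]
  constructor
  · rintro ⟨q, x, y, h⟩
    exact ⟨q.plug, q.isContext, x, y, h⟩
  · rintro ⟨φ, hφ, x, y, h⟩
    obtain ⟨q, rfl⟩ := hφ.exists_starWord
    exact ⟨q, x, y, h⟩

theorem mem_Irr_of_br {w : Word X} (h : br w ∈ Irr X) : w ∈ Irr X := by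
  by_contra hw
  obtain ⟨φ, hφ, x, y, rfl⟩ := not_mem_Irr_iff.1 hw
  exact not_mem_Irr_iff.2 ⟨_, hφ.br, x, y, rfl⟩ h

theorem mem_Irr_of_mul_left {v w : Word X} (h : v * w ∈ Irr X) : v ∈ Irr X := by
  by_contra hw
  obtain ⟨φ, hφ, x, y, rfl⟩ := not_mem_Irr_iff.1 hw
  exact not_mem_Irr_iff.2 ⟨_, hφ.mul_right w, x, y, rfl⟩ h

theorem mem_Irr_of_mul_right {v w : Word X} (h : v * w ∈ Irr X) : w ∈ Irr X := by
  by_contra hw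
  obtain ⟨φ, hφ, x, y, rfl⟩ := not_mem_Irr_iff.1 hw
  exact not_mem_Irr_iff.2 ⟨_, hφ.mul_left v, x, y, rfl⟩ h

theorem ne_mul_br_of_br_mem_Irr {w : Word X} (h : br w ∈ Irr X) (a y : Word X) :
    w ≠ a * br y := by
  rintro rfl
  exact not_mem_Irr_iff.2 ⟨_, .id, a, y, rfl⟩ h

/-! ### Degrees and paths -/

theorem degList_append (l l' : List (PrimeWord X)) :
    degList (l ++ l') = degList l + degList l' := by
  induction l with
  | nil => simp [degList]
  | cons a l ih => simp [degList, ih, add_assoc]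

theorem deg_mul (v w : Word X) : deg (v * w) = deg v + deg w := by
  obtain ⟨a, l⟩ := v
  obtain ⟨b, l'⟩ := w
  simp [deg, degList_append, degList, add_assoc]

theorem deg_br (w : Word X) : deg (br w) = deg w := by
  simp [br, FreeSemigroup.of, deg, degPrime, degList]

theorem deg_letter (x : X) : deg (letter x) = 1 := by
  simp [letter, FreeSemigroup.of, deg, degPrime, degList]

theorem deg_pos (w : Word X) : 0 < deg w := by
  induction w using word_induction with
  | hletter x => simp [deg_letter]
  | hbr w ih => rwa [deg_br]
  | hmul v w ihv ihw => rw [deg_mul]; lia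

/-- The paths of the letters of a word inside its prime factors, from left to right. -/
def factorPaths (w : Word X) : List (List (PathLetter X)) := pathsPrime w.head ++ pathsList w.tail

theorem pathsList_append (l l' : List (PrimeWord X)) :
    pathsList (l ++ l') = pathsList l ++ pathsList l' := by
  induction l with
  | nil => simp [pathsList]
  | cons a l ih => simp [pathsList, ih]

theorem factorPaths_mul (v w : Word X) :
    factorPaths (v * w) = factorPaths v ++ factorPaths w := by
  obtain ⟨a, l⟩ := v
  obtain ⟨b, l'⟩ := w
  simp [factorPaths, FreeSemigroup.mk_mul_mk, pathsList_append, pathsList]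

theorem factorPaths_br (w : Word X) :
    factorPaths (br w) = (paths w).map (fun p => PathLetter.P :: p) := by
  simp [factorPaths, br, FreeSemigroup.of, pathsPrime, pathsList]

theorem paths_br (w : Word X) : paths (br w) = (paths w).map (fun p => PathLetter.P :: p) := by
  simp [br, FreeSemigroup.of, paths, pathsPrime]

theorem paths_letter (x : X) : paths (letter x) = [[PathLetter.ofVar x]] := by
  simp [letter, FreeSemigroup.of, paths, pathsPrime]

theorem paths_mul (v w : Word X) :
    paths (v * w) = (factorPaths v ++ factorPaths w).map (fun p => PathLetter.mu :: p) := by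
  rw [← factorPaths_mul]
  obtain ⟨a, l⟩ := v
  obtain ⟨b, l'⟩ := w
  cases l <;> simp [factorPaths, FreeSemigroup.mk_mul_mk, paths]

theorem paths_eq_or (w : Word X) :
    paths w = factorPaths w ∨ paths w = (factorPaths w).map (fun p => PathLetter.mu :: p) := by
  obtain ⟨a, l⟩ := w
  cases l <;> simp [factorPaths, paths, pathsList]

theorem length_paths (w : Word X) : (paths w).length = deg w := by
  induction w using word_induction with
  | hletter x => simp [paths_letter, deg_letter]
  | hbr w ih => simpa [paths_br, deg_br] using ih
  | hmul v w ihv ihw =>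
    have h : ∀ w : Word X, (factorPaths w).length = (paths w).length := fun w => by
      rcases paths_eq_or w with h | h <;> simp [h]
    simp [paths_mul, deg_mul, h, ihv, ihw]

/-- The last paths at which the sequences differ exist, and there the first sequence has the
shorter path. -/
def RightShorter {L : Type*} (l' l : List (List L)) : Prop :=
  ∃ t' t p' p s, l' = t' ++ p' :: s ∧ l = t ++ p :: s ∧ p'.length < p.length

theorem RightShorter.map_cons {L : Type*} {l' l : List (List L)} (h : RightShorter l' l) (a : L) :
    RightShorter (l'.map (fun p => a :: p)) (l.map (fun p => a :: p)) := by
  obtain ⟨t', t, p', p, s, rfl, rfl, hp⟩ := h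
  exact ⟨t'.map (a :: ·), t.map (a :: ·), a :: p', a :: p, s.map (a :: ·), by simp, by simp,
    by simpa using hp⟩

theorem RightShorter.append_left {L : Type*} {l' l : List (List L)} (h : RightShorter l' l)
    (x : List (List L)) : RightShorter (x ++ l') (x ++ l) := by
  obtain ⟨t', t, p', p, s, rfl, rfl, hp⟩ := h
  exact ⟨x ++ t', x ++ t, p', p, s, by simp, by simp, hp⟩

theorem RightShorter.append_right {L : Type*} {l' l : List (List L)} (h : RightShorter l' l)
    (x : List (List L)) : RightShorter (l' ++ x) (l ++ x) := by
  obtain ⟨t', t, p', p, s, rfl, rfl, hp⟩ := h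
  exact ⟨t', t, p', p, s ++ x, by simp, by simp, hp⟩

/-- `v` is below `w` because the rightmost difference of their paths is one of length; this
persists in all contexts. -/
structure Dominated (v w : Word X) : Prop where
  deg_eq : deg v = deg w
  paths : RightShorter (paths v) (paths w)
  factorPaths : RightShorter (factorPaths v) (factorPaths w)

/-- A bracket prefixes `P` to the full paths, whereas a product prefixes one `μ` to the factor
paths, so the induction must carry both comparisons. An outer factor only adds the same paths on
both sides. -/
theorem Dominated.context {v w : Word X} (h : Dominated v w) {φ : Word X → Word X}
    (hφ : IsContext φ) : Dominated (φ v) (φ w) := by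
  induction hφ with
  | id => exact h
  | br _ ih =>
    exact ⟨by rw [deg_br, deg_br, ih.deg_eq],
      by simpa only [paths_br] using ih.paths.map_cons _,
      by simpa only [factorPaths_br] using ih.paths.map_cons _⟩
  | mul_left x _ ih =>
    exact ⟨by rw [deg_mul, deg_mul, ih.deg_eq],
      by simpa only [paths_mul] using (ih.factorPaths.append_left _).map_cons _,
      by simpa only [factorPaths_mul] using ih.factorPaths.append_left _⟩
  | mul_right x _ ih =>
    exact ⟨by rw [deg_mul, deg_mul, ih.deg_eq],
      by simpa only [paths_mul] using (ih.factorPaths.append_right _).map_cons _,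
      by simpa only [factorPaths_mul] using ih.factorPaths.append_right _⟩

/-- The two sequences differ at most by one `μ` in front of every path, and a word has at least one
letter. -/
theorem exists_last_path (y : Word X) : ∃ t' p' t p, factorPaths y = t' ++ [p'] ∧
    paths y = t ++ [p] ∧ p'.length ≤ p.length := by
  have hne : factorPaths y ≠ [] := by
    intro h
    have h1 := length_paths y
    have h2 := deg_pos y
    rcases paths_eq_or y with h' | h' <;> rw [h', h] at h1 <;> simp at h1 <;> lia
  obtain ⟨t, p, h⟩ := List.eq_nil_or_concat (factorPaths y) |>.resolve_left hne
  rw [List.concat_eq_append] at h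
  rcases paths_eq_or y with h' | h'
  · exact ⟨t, p, t, p, h, by rw [h', h], le_rfl⟩
  · exact ⟨t, p, t.map (PathLetter.mu :: ·), PathLetter.mu :: p, h, by rw [h', h]; simp, by simp⟩

/-- The last letter decides: its path is `Pμp'` against `PμPp`, where `p'` and `p` are its paths in
the factors of `y` and in `y`. -/
theorem dominated_br_br_mul (x y : Word X) : Dominated (br (br x * y)) (br (x * br y)) := by
  obtain ⟨t', p', t, p, h', h, hp⟩ := exists_last_path y
  have key : RightShorter (factorPaths (br x * y)) (factorPaths (x * br y)) := by
    rw [factorPaths_mul, factorPaths_mul, factorPaths_br y, h, h']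
    exact ⟨factorPaths (br x) ++ t', factorPaths x ++ t.map (PathLetter.P :: ·), p',
      PathLetter.P :: p, [], by simp, by simp, by simp; lia⟩
  refine ⟨by simp [deg_br, deg_mul], ?_, ?_⟩
  · rw [paths_br, paths_br, paths_mul, paths_mul, ← factorPaths_mul, ← factorPaths_mul]
    exact (key.map_cons _).map_cons _
  · rw [factorPaths_br, factorPaths_br, paths_mul, paths_mul, ← factorPaths_mul, ← factorPaths_mul]
    exact (key.map_cons _).map_cons _

theorem dominated_br_mul (x y : Word X) : Dominated (br (x * y)) (br (x * br y)) := by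
  obtain ⟨t', p', t, p, h', h, hp⟩ := exists_last_path y
  have key : RightShorter (factorPaths (x * y)) (factorPaths (x * br y)) := by
    rw [factorPaths_mul, factorPaths_mul, factorPaths_br y, h, h']
    exact ⟨factorPaths x ++ t', factorPaths x ++ t.map (PathLetter.P :: ·), p',
      PathLetter.P :: p, [], by simp, by simp, by simp; lia⟩
  refine ⟨by simp [deg_br, deg_mul], ?_, ?_⟩
  · rw [paths_br, paths_br, paths_mul, paths_mul, ← factorPaths_mul, ← factorPaths_mul]
    exact (key.map_cons _).map_cons _
  · rw [factorPaths_br, factorPaths_br, paths_mul, paths_mul, ← factorPaths_mul, ← factorPaths_mul]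
    exact (key.map_cons _).map_cons _

/-- The last letter has path `μPp` against `PμPp`; without the outer `μ` on the left, the gap only
grows. -/
theorem dominated_br_mul_br (x y : Word X) : Dominated (br x * br y) (br (x * br y)) := by
  obtain ⟨t', p', t, p, h', h, hp⟩ := exists_last_path y
  refine ⟨by simp [deg_br, deg_mul], ?_, ?_⟩
  · rw [paths_br, paths_mul, paths_mul, factorPaths_br y, h]
    refine ⟨(factorPaths (br x) ++ t.map (PathLetter.P :: ·)).map (PathLetter.mu :: ·),
      ((factorPaths x ++ t.map (PathLetter.P :: ·)).map (PathLetter.mu :: ·)).map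
        (PathLetter.P :: ·), PathLetter.mu :: PathLetter.P :: p,
      PathLetter.P :: PathLetter.mu :: PathLetter.P :: p, [], ?_, ?_, ?_⟩ <;> simp
  · rw [factorPaths_br (x * br y), factorPaths_mul, paths_mul, factorPaths_br y, h]
    refine ⟨factorPaths (br x) ++ t.map (PathLetter.P :: ·),
      ((factorPaths x ++ t.map (PathLetter.P :: ·)).map (PathLetter.mu :: ·)).map
        (PathLetter.P :: ·), PathLetter.P :: p,
      PathLetter.P :: PathLetter.mu :: PathLetter.P :: p, [], ?_, ?_, ?_⟩ <;> simp

end Words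

/-! ### The order `≤_{PL_r}` -/

section Order
variable {X : Type*} [LinearOrder X]

theorem strict_plr_iff {v w : Word X} : Strict plr v w ↔ plrKey v < plrKey w :=
  lt_iff_le_not_ge.symm

theorem strict_plr_trans {u v w : Word X} (h : Strict plr u v) (h' : Strict plr v w) :
    Strict plr u w :=
  strict_plr_iff.2 ((strict_plr_iff.1 h).trans (strict_plr_iff.1 h'))

/-- Reversal turns the common tail into a common prefix, and the degree lexicographical order looks
at lengths first. -/
theorem Dominated.strict_plr {v w : Word X} (h : Dominated v w) : Strict plr v w := by
  rw [strict_plr_iff, plrKey, plrKey, Prod.Lex.toLex_lt_toLex]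
  refine .inr ⟨h.deg_eq, ?_⟩
  obtain ⟨t', t, p', p, s, h', h, hp⟩ := h.paths
  simp only [pathsRight, h', h, List.reverse_append, List.reverse_cons, List.map_append,
    List.append_assoc, List.map_cons, List.map_nil]
  refine List.Lex.append_left (· < ·) (List.Lex.rel ?_) _
  exact Prod.Lex.toLex_lt_toLex.2 (.inl hp)

/-- Arbitrary pairs of a number and a list are not well-founded under the lexicographic order; only
those of the form `dlexKey p` are. Comparisons of keys are therefore pulled back to paths. -/
theorem lex_of_lex_map {α β : Type*} {r : β → β → Prop} {f : α → β}
    (hf : Function.Injective f) {l l' : List α}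
    (h : List.Lex r (l.map f) (l'.map f)) : List.Lex (fun a b => r (f a) (f b)) l l' := by
  induction l generalizing l' with
  | nil =>
    cases l' with
    | nil => cases h
    | cons b l' => exact .nil
  | cons a l ih =>
    cases l' with
    | nil => cases h
    | cons b l' =>
      rw [List.map_cons, List.map_cons, List.cons_lex_cons_iff] at h
      rcases h with h | ⟨hab, h⟩
      · exact .rel h
      · obtain rfl := hf hab
        exact .cons (ih h)

/-- The degree is the number of paths, so the order is a shortlex order on sequences of paths,
themselves compared by shortlex over a well-ordered alphabet. -/
theorem wellFounded_strict_plr [WellFoundedLT X] : WellFounded (Strict (plr (X := X))) := by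
  have wf₁ : WellFounded fun p q : List (PathLetter X) => dlexKey p < dlexKey q := by
    refine (List.Shortlex.wf (wellFounded_lt (α := PathLetter X))).mono fun p q h => ?_
    exact List.shortlex_def.2 (Prod.Lex.toLex_lt_toLex.1 h)
  refine (InvImage.wf (fun w : Word X => (paths w).reverse) (List.Shortlex.wf wf₁)).mono ?_
  intro v w h
  rw [strict_plr_iff, plrKey, plrKey, Prod.Lex.toLex_lt_toLex] at h
  refine List.shortlex_def.2 ?_
  simp only [List.length_reverse, length_paths]
  refine h.imp id fun h => ⟨h.1, ?_⟩
  exact lex_of_lex_map (fun p q h => congrArg (fun z => (ofLex z).2) h) h.2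

end Order

section Operator
variable {k : Type*} [CommRing k] {X : Type*}

/-! ### Linear maps out of `k𝔖(X)` -/

/-- The linear extension to `k𝔖(X)` of a map on words with values in a module. -/
noncomputable def extend {M : Type*} [AddCommGroup M] [Module k M] (f : Word X → M) :
    WordAlg k X →ₗ[k] M :=
  (MonoidAlgebra.basis (Word X) k).constr k f

theorem extend_mono {M : Type*} [AddCommGroup M] [Module k M] (f : Word X → M) (w : Word X) :
    extend f (mono k w) = f w := by
  have h := (MonoidAlgebra.basis (Word X) k).constr_basis k f w
  rwa [MonoidAlgebra.basis_apply] at h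

theorem coeff_mono_self (w : Word X) : (mono k w).coeff w = 1 := by simp [mono]

theorem mono_mul_mono (v w : Word X) : mono k v * mono k w = mono k (v * w) := by
  simp [mono, MonoidAlgebra.single_mul_single]

theorem span_mono : Submodule.span k (Set.range (mono k (X := X))) = ⊤ := by
  have h := (MonoidAlgebra.basis (Word X) k).span_eq
  convert h using 3
  funext w
  rw [MonoidAlgebra.basis_apply, mono]

theorem mem_span_mono_iff {T : Set (Word X)} {f : WordAlg k X} :
    f ∈ Submodule.span k (mono k '' T) ↔ ∀ w ∈ f.coeff.support, w ∈ T := by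
  have h := MonoidAlgebra.supported_eq_span_single (R := k) (s := T)
  rw [show mono k (X := X) = fun w => MonoidAlgebra.single w 1 from rfl, ← h,
    MonoidAlgebra.mem_supported]
  exact Iff.rfl

theorem eq_sum_mono (f : WordAlg k X) :
    f = ∑ w ∈ f.coeff.support, f.coeff w • mono k w := by
  classical
  ext w
  simp [mono, Finsupp.single_apply]

theorem linearMap_ext {M : Type*} [AddCommGroup M] [Module k M] {f g : WordAlg k X →ₗ[k] M}
    (h : ∀ w, f (mono k w) = g (mono k w)) : f = g :=
  LinearMap.ext_on_range span_mono h

theorem linExt_mono (φ : Word X → Word X) (w : Word X) :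
    linExt φ (mono k w) = mono k (φ w) := by
  simp [linExt, mono]

/-! ### The Rota–Baxter operator on `k𝔖(X)` -/

/-- The length of the path of the last letter of a word inside its last prime factor. -/
def lastLength (w : Word X) : ℕ := ((factorPaths w).getLastD []).length

theorem lastLength_mul (v w : Word X) : lastLength (v * w) = lastLength w := by
  obtain ⟨t', p', t, p, h, -⟩ := exists_last_path w
  simp [lastLength, factorPaths_mul, h, ← List.append_assoc, List.getLastD_eq_getLast?]

theorem lastLength_lt_br (w : Word X) : lastLength w < lastLength (br w) := by
  obtain ⟨t', p', t, p, h, h', hp⟩ := exists_last_path w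
  simp [lastLength, factorPaths_br, h, h', List.getLastD_eq_getLast?]
  lia

/-- Well-founded induction and recursion on words is along the degree and then `lastLength`. -/
def wordRank (w : Word X) : ℕ ×ₗ ℕ := toLex (deg w, lastLength w)

theorem wordRank_lt_of_deg_lt {v w : Word X} (h : deg v < deg w) : wordRank v < wordRank w :=
  Prod.Lex.toLex_lt_toLex.2 (.inl h)

/-- Serves both recursive calls of the same degree: `u = a` for the term `P(ay)`, and `u` a monomial
of `P(a)` for `P(P(a)y)`. -/
theorem wordRank_mul_lt {u v a y : Word X} (hu : deg u = deg a) (hv : v = a * br y) :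
    wordRank (u * y) < wordRank v := by
  subst hv
  refine Prod.Lex.toLex_lt_toLex.2 (.inr ⟨by simp [deg_mul, deg_br, hu], ?_⟩)
  simpa [lastLength_mul] using lastLength_lt_br y

theorem wordRank_lt_mul_left (a y : Word X) : wordRank a < wordRank (a * y) :=
  wordRank_lt_of_deg_lt (by have := deg_pos y; rw [deg_mul]; lia)

/-- A word is tame if it is not of the form `a⌊y⌋` with `y` tame. -/
def Tame (w : Word X) : Prop := ∀ a y, (h : w = a * br y) → ¬ Tame y
termination_by lastLength w
decreasing_by subst h; rw [lastLength_mul]; exact lastLength_lt_br y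

theorem tame_iff (w : Word X) : Tame w ↔ ∀ a y, w = a * br y → ¬ Tame y := by
  rw [Tame]

open Classical in
/-- The value on a word of the Rota–Baxter operator of weight `c` on `k𝔖(X)` that agrees with the
bracket on tame words. -/
noncomputable def rbWord (c : k) (w : Word X) : WordAlg k X :=
  if h : ∃ z : Word X × Word X, w = z.1 * br z.2 ∧ Tame z.2 then
    -- The Rota–Baxter identity for `(a, y)` solved for `P(a P(y))`, with `P(y) = ⌊y⌋`.
    rbWord c h.choose.1 * mono k (br h.choose.2)
      -- The degree test is there for termination only: that `P(a)` is homogeneous of degree `deg a`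
      -- can be proved only after the definition.
      - ∑ u ∈ (rbWord c h.choose.1).coeff.support, (if _hu : deg u = deg h.choose.1 then
          (rbWord c h.choose.1).coeff u • rbWord c (u * h.choose.2) else 0)
      - c • rbWord c (h.choose.1 * h.choose.2)
  else mono k (br w)
termination_by wordRank w
decreasing_by
  all_goals
    first
    | exact wordRank_mul_lt ‹_› h.choose_spec.1
    | exact wordRank_mul_lt rfl h.choose_spec.1
    | (conv_rhs => rw [h.choose_spec.1]
       exact wordRank_lt_mul_left _ _)

theorem rbWord_of_tame (c : k) {w : Word X} (hw : Tame w) : rbWord c w = mono k (br w) := by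
  rw [rbWord, dif_neg]
  rintro ⟨z, h, hz⟩
  exact (tame_iff w).1 hw _ _ h hz

theorem rbWord_mul_br_aux (c : k) (a : Word X) {y : Word X} (hy : Tame y) :
    rbWord c (a * br y) = rbWord c a * mono k (br y)
      - ∑ u ∈ (rbWord c a).coeff.support, (if deg u = deg a then
          (rbWord c a).coeff u • rbWord c (u * y) else 0)
      - c • rbWord c (a * y) := by
  have h : ∃ z : Word X × Word X, a * br y = z.1 * br z.2 ∧ Tame z.2 := ⟨(a, y), rfl, hy⟩
  obtain ⟨h1, h2⟩ := mul_br_inj h.choose_spec.1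
  rw [rbWord, dif_pos h, ← h1, ← h2]
  simp only [dite_eq_ite]

variable (X) in
/-- The homogeneous component of degree `n` of `k𝔖(X)`. -/
noncomputable def homogeneous (k : Type*) [CommRing k] (n : ℕ) : Submodule k (WordAlg k X) :=
  Submodule.span k (mono k '' {w : Word X | deg w = n})

theorem mem_homogeneous_iff {n : ℕ} {f : WordAlg k X} :
    f ∈ homogeneous X k n ↔ ∀ w ∈ f.coeff.support, deg w = n :=
  mem_span_mono_iff

theorem mono_mem_homogeneous (w : Word X) : mono k w ∈ homogeneous X k (deg w) :=
  Submodule.subset_span ⟨w, rfl, rfl⟩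

theorem mul_mono_mem_homogeneous {n : ℕ} {f : WordAlg k X} (hf : f ∈ homogeneous X k n)
    (w : Word X) : f * mono k w ∈ homogeneous X k (n + deg w) := by
  induction hf using Submodule.span_induction with
  | mem f hf =>
    obtain ⟨v, rfl, rfl⟩ := hf
    rw [mono_mul_mono, ← deg_mul]
    exact mono_mem_homogeneous _
  | zero => simp
  | add f g _ _ hf hg => rw [add_mul]; exact add_mem hf hg
  | smul r f _ hf => rw [smul_mul_assoc]; exact Submodule.smul_mem _ _ hf

/-- Every term of the recursion keeps the degree. Hence the degree test in `rbWord` always succeeds.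
-/
theorem rbWord_mem_homogeneous (c : k) (w : Word X) : rbWord c w ∈ homogeneous X k (deg w) := by
  induction w using (InvImage.wf wordRank wellFounded_lt).induction with
  | _ w ih =>
    by_cases hw : Tame w
    · rw [rbWord_of_tame c hw, ← deg_br]
      exact mono_mem_homogeneous _
    · rw [tame_iff] at hw
      push Not at hw
      obtain ⟨a, y, rfl, hy⟩ := hw
      have hd : deg (a * br y) = deg (a * y) := by simp [deg_mul, deg_br]
      rw [rbWord_mul_br_aux c a hy]
      refine sub_mem (sub_mem ?_ (Submodule.sum_mem _ fun u _ => ?_)) (Submodule.smul_mem _ _ ?_)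
      · rw [deg_mul]
        exact mul_mono_mem_homogeneous (ih a (wordRank_lt_mul_left _ _)) _
      · split_ifs with hu
        · refine Submodule.smul_mem _ _ ?_
          have h := ih (u * y) (wordRank_mul_lt hu rfl)
          rwa [deg_mul, hu, ← deg_mul, ← hd] at h
        · exact zero_mem _
      · have h := ih (a * y) (wordRank_mul_lt rfl rfl)
        rwa [← hd] at h

variable (X) in
/-- The Rota–Baxter operator of weight `c` on `k𝔖(X)` that agrees with the bracket on tame
words. -/
noncomputable def rbOp (c : k) : WordAlg k X →ₗ[k] WordAlg k X := extend (rbWord c)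

theorem rbOp_mono (c : k) (w : Word X) : rbOp X c (mono k w) = rbWord c w := extend_mono _ w

theorem rbOp_mono_mul_mono_br (c : k) (a : Word X) {y : Word X} (hy : Tame y) :
    rbOp X c (mono k a * mono k (br y)) = rbOp X c (mono k a) * mono k (br y)
      - rbOp X c (rbOp X c (mono k a) * mono k y) - c • rbOp X c (mono k a * mono k y) := by
  have h : rbOp X c (rbWord c a * mono k y) = ∑ u ∈ (rbWord c a).coeff.support,
      (if deg u = deg a then (rbWord c a).coeff u • rbWord c (u * y) else 0) := by
    conv_lhs => rw [eq_sum_mono (rbWord c a), Finset.sum_mul, map_sum]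
    refine Finset.sum_congr rfl fun u hu => ?_
    rw [if_pos (mem_homogeneous_iff.1 (rbWord_mem_homogeneous c a) u hu), smul_mul_assoc,
      map_smul, mono_mul_mono, rbOp_mono]
  rw [rbOp_mono, h, mono_mul_mono, mono_mul_mono, rbOp_mono, rbOp_mono, rbWord_mul_br_aux c a hy]

section RotaBaxter
variable {A : Type*} [NonUnitalRing A] [Module k A]

/-- The Rota–Baxter identity of weight `c` for the pair `(x, y)`. -/
def RotaBaxterAt (c : k) (P : A →ₗ[k] A) (x y : A) : Prop :=
  P x * P y = P (P x * y) + P (x * P y) + c • P (x * y)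

/-- Both sides of the identity are linear in each argument. -/
theorem rotaBaxterAt_of_span_left [IsScalarTower k A A] {c : k} {P : A →ₗ[k] A} {s : Set A} {y : A}
    (hs : Submodule.span k s = ⊤) (h : ∀ x ∈ s, RotaBaxterAt c P x y) (x : A) :
    RotaBaxterAt c P x y := by
  have hx : x ∈ Submodule.span k s := hs.ge Submodule.mem_top
  unfold RotaBaxterAt at h ⊢
  induction hx using Submodule.span_induction with
  | mem x hx => exact h x hx
  | zero => simp
  | add x z _ _ hx hz =>
    simp only [map_add, add_mul, hx, hz]
    module
  | smul r x _ hx =>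
    simp only [map_smul, smul_mul_assoc, hx]
    module

theorem rotaBaxterAt_of_span_right [SMulCommClass k A A] {c : k} {P : A →ₗ[k] A} {s : Set A} {x : A}
    (hs : Submodule.span k s = ⊤) (h : ∀ y ∈ s, RotaBaxterAt c P x y) (y : A) :
    RotaBaxterAt c P x y := by
  have hy : y ∈ Submodule.span k s := hs.ge Submodule.mem_top
  unfold RotaBaxterAt at h ⊢
  induction hy using Submodule.span_induction with
  | mem y hy => exact h y hy
  | zero => simp
  | add y z _ _ hy hz =>
    simp only [map_add, mul_add, hy, hz]
    module
  | smul r y _ hy =>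
    simp only [map_smul, mul_smul_comm, hy]
    module

/-- The Rota–Baxter identity for a right factor `U·P(V)` follows from that identity for the right
factors `V`, `U`, `P(U)V` and `UV`. -/
theorem rotaBaxterAt_mul_op [IsScalarTower k A A] [SMulCommClass k A A] (c : k) (P : A →ₗ[k] A) {U V : A}
    (hV : ∀ a, RotaBaxterAt c P a V)
    (hU : ∀ a, RotaBaxterAt c P a U) (hPUV : ∀ a, RotaBaxterAt c P a (P U * V))
    (hUV : ∀ a, RotaBaxterAt c P a (U * V)) (a : A) :
    RotaBaxterAt c P a (U * P V) := by
  unfold RotaBaxterAt at *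
  have e : P (U * P V) = P U * P V - P (P U * V) - c • P (U * V) := by
    rw [hV U]; abel
  -- Expand `P a * P U`, then apply the identity at `V` to each of the three products with `P V`.
  have e1 : P a * P U * P V = P (P (P a * U) * V) + P (P a * U * P V) + c • P (P a * U * V)
      + (P (P (a * P U) * V) + P (a * P U * P V) + c • P (a * P U * V))
      + c • (P (P (a * U) * V) + P (a * U * P V) + c • P (a * U * V)) := by
    rw [hU a, add_mul, add_mul, smul_mul_assoc, hV, hV, hV]
  -- The nested terms here cancel those of the form `P (P _ * V)` in `e1`.
  have e2 : P (P a * (P U * V)) = P (P (P a * U) * V) + P (P (a * P U) * V)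
      + c • P (P (a * U) * V) := by
    rw [← mul_assoc, hU a, add_mul, add_mul, map_add, map_add, smul_mul_assoc, map_smul]
  rw [e, mul_sub, mul_sub, ← mul_assoc, e1, hPUV, e2, mul_smul_comm, hUV, mul_sub, mul_sub,
    map_sub, map_sub, mul_smul_comm, map_smul]
  simp only [mul_assoc]
  module

end RotaBaxter

/-- Induction on the rank of the right argument `b`. For tame `b` the identity is the definition;
otherwise `b = u P(v)` with `v` tame, and associativity reduces it to right arguments `v`, `u`,
`P(u)v` and `uv`. -/
theorem isRotaBaxter_rbOp (c : k) : IsRotaBaxter c (rbOp X c) := by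
  suffices H : ∀ b : Word X, ∀ f : WordAlg k X, RotaBaxterAt c (rbOp X c) f (mono k b) from
    fun f => rotaBaxterAt_of_span_right span_mono (Set.forall_mem_range.2 fun b => H b f)
  have tame : ∀ b : Word X, Tame b → ∀ f : WordAlg k X,
      RotaBaxterAt c (rbOp X c) f (mono k b) := by
    intro b hb
    refine rotaBaxterAt_of_span_left span_mono (Set.forall_mem_range.2 fun a => ?_)
    rw [RotaBaxterAt, rbOp_mono c b, rbWord_of_tame c hb, rbOp_mono_mul_mono_br c a hb]
    abel
  intro b
  induction b using (InvImage.wf wordRank wellFounded_lt).induction with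
  | _ b ih =>
    by_cases hb : Tame b
    · exact tame b hb
    · rw [tame_iff] at hb
      push Not at hb
      obtain ⟨u, v, rfl, hv⟩ := hb
      have hv' : mono k (u * br v) = mono k u * rbOp X c (mono k v) := by
        rw [rbOp_mono, rbWord_of_tame c hv, mono_mul_mono]
      rw [hv']
      refine rotaBaxterAt_mul_op c _ (tame v hv) (ih u (wordRank_lt_mul_left _ _)) ?_ ?_
      · intro f
        -- By homogeneity `P(u)v` is a combination of words `zv` with `deg z = deg u`, all of
        -- smaller rank than `u⌊v⌋`.
        rw [RotaBaxterAt, rbOp_mono c u, eq_sum_mono (rbWord c u)]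
        simp only [Finset.sum_mul, Finset.mul_sum, map_sum, Finset.smul_sum,
          ← Finset.sum_add_distrib]
        refine Finset.sum_congr rfl fun z hz => ?_
        have h := ih (z * v) (wordRank_mul_lt
          (mem_homogeneous_iff.1 (rbWord_mem_homogeneous c u) z hz) rfl) f
        rw [RotaBaxterAt, ← mono_mul_mono] at h
        simp only [smul_mul_assoc, mul_smul_comm, map_smul, h]
        module
      · rw [mono_mul_mono]
        exact ih (u * v) (wordRank_mul_lt rfl rfl)

end Operator

section Universal
variable {k : Type*} [CommRing k] {X : Type*}

/-! ### Operated ideals and contexts -/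

theorem subset_opIdeal {A : Type*} [NonUnitalRing A] [Module k A] (P : A →ₗ[k] A) (S : Set A) :
    S ⊆ opIdeal P S := fun s hs => by
  simp only [opIdeal, SetLike.mem_coe, Submodule.mem_sInf]
  exact fun I hI => hI.1 hs

theorem opIdeal_le {A : Type*} [NonUnitalRing A] [Module k A] {P : A →ₗ[k] A} {S : Set A}
    {I : Submodule k A} (hS : S ⊆ I) (hI : IsOperatedIdeal P I) : opIdeal P S ≤ I :=
  sInf_le ⟨hS, hI⟩

theorem brAlg_mono (w : Word X) : brAlg k X (mono k w) = mono k (br w) := linExt_mono br w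

theorem IsContext.linExt_mem {I : Submodule k (WordAlg k X)} (hI : IsOperatedIdeal (brAlg k X) I)
    {φ : Word X → Word X} (hφ : IsContext φ) {f : WordAlg k X} (hf : f ∈ I) :
    linExt φ f ∈ I := by
  induction hφ with
  | id =>
    have h : linExt (k := k) (fun u : Word X => u) = LinearMap.id :=
      linearMap_ext fun w => by simp [linExt_mono]
    simpa [h] using hf
  | @br φ _ ih =>
    have h : linExt (k := k) (fun u => OperatedGS.br (φ u)) = brAlg k X ∘ₗ linExt φ :=
      linearMap_ext fun w => by simp [linExt_mono, brAlg_mono]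
    rw [h]
    exact hI.op _ ih
  | @mul_left φ x _ ih =>
    have h : linExt (k := k) (fun u => x * φ u) = LinearMap.mulLeft k (mono k x) ∘ₗ linExt φ :=
      linearMap_ext fun w => by simp [linExt_mono, mono_mul_mono]
    rw [h]
    exact hI.mul_left _ _ ih
  | @mul_right φ x _ ih =>
    have h : linExt (k := k) (fun u => φ u * x) = LinearMap.mulRight k (mono k x) ∘ₗ linExt φ :=
      linearMap_ext fun w => by simp [linExt_mono, mono_mul_mono]
    rw [h]
    exact hI.mul_right _ ih _

theorem plugAlg_mem_opIdeal (c : k) (q : StarWord X) {s : WordAlg k X}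
    (hs : s ∈ Srbr X c) : q.plugAlg s ∈ opIdeal (brAlg k X) (Srbr X c) :=
  q.isContext.linExt_mem (opIdeal_isOperatedIdeal _ _) (subset_opIdeal _ _ hs)

/-! ### Evaluation of words in an algebra with an operator -/

section Eval
variable {A : Type*} [NonUnitalRing A]

mutual
/-- The value of a prime bracketed word. -/
def evalPrime (Q : A → A) (f : X → A) : PrimeWord X → A
  | PrimeWord.var x => f x
  | PrimeWord.bracket w => Q (evalWord Q f w)
/-- The value of a bracketed word when letters are evaluated by `f` and brackets by `Q`. -/
def evalWord (Q : A → A) (f : X → A) : Word X → A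
  | ⟨a, l⟩ => evalList Q f l (evalPrime Q f a)
/-- The product of an element and the values of a list of prime bracketed words. -/
def evalList (Q : A → A) (f : X → A) : List (PrimeWord X) → A → A
  | [], z => z
  | a :: l, z => evalList Q f l (z * evalPrime Q f a)
end

variable (Q : A → A) (f : X → A)

/-- The accumulator `z` stands in for an empty product, as `A` need not have a unit. -/
theorem evalList_mul (l : List (PrimeWord X)) (y z : A) :
    evalList Q f l (y * z) = y * evalList Q f l z := by
  induction l generalizing z with
  | nil => simp [evalList]
  | cons a l ih => simp only [evalList]; rw [mul_assoc, ih]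

theorem evalList_append (l l' : List (PrimeWord X)) (z : A) :
    evalList Q f (l ++ l') z = evalList Q f l' (evalList Q f l z) := by
  induction l generalizing z with
  | nil => simp [evalList]
  | cons a l ih => simp [evalList, ih]

theorem evalWord_mul (v w : Word X) : evalWord Q f (v * w) = evalWord Q f v * evalWord Q f w := by
  obtain ⟨a, l⟩ := v
  obtain ⟨b, l'⟩ := w
  simp [evalWord, evalList_append, evalList, evalList_mul]

theorem evalWord_br (w : Word X) : evalWord Q f (br w) = Q (evalWord Q f w) := by
  simp [br, FreeSemigroup.of, evalWord, evalList, evalPrime]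

theorem evalWord_letter (x : X) : evalWord Q f (letter x) = f x := by
  simp [letter, FreeSemigroup.of, evalWord, evalList, evalPrime]

end Eval

section EvalAlg
variable {A : Type*} [NonUnitalRing A] [Module k A] [IsScalarTower k A A] [SMulCommClass k A A]
  (Q : A →ₗ[k] A) (f : X → A)

/-- The homomorphism of operated algebras from `k𝔖(X)` that extends `f`. -/
noncomputable def evalAlg : WordAlg k X →ₙₐ[k] A :=
  MonoidAlgebra.liftMagma k ⟨evalWord Q f, evalWord_mul Q f⟩

theorem evalAlg_mono (w : Word X) : evalAlg Q f (mono k w) = evalWord Q f w := by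
  simp [evalAlg, mono]

theorem evalAlg_brAlg (g : WordAlg k X) : evalAlg Q f (brAlg k X g) = Q (evalAlg Q f g) := by
  have h : (evalAlg Q f : WordAlg k X →ₗ[k] A) ∘ₗ brAlg k X
      = Q ∘ₗ (evalAlg Q f : WordAlg k X →ₗ[k] A) :=
    linearMap_ext fun w => by simp [brAlg_mono, evalAlg_mono, evalWord_br]
  exact LinearMap.congr_fun h g

/-- The kernel of the evaluation is an operated ideal containing the relations. -/
theorem evalAlg_eq_zero {c : k} (hQ : IsRotaBaxter c Q) {g : WordAlg k X}
    (hg : g ∈ opIdeal (brAlg k X) (Srbr X c)) : evalAlg Q f g = 0 := by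
  have hle : opIdeal (brAlg k X) (Srbr X c) ≤
      LinearMap.ker (evalAlg Q f : WordAlg k X →ₗ[k] A) := by
    refine opIdeal_le ?_ ⟨?_, ?_, ?_⟩
    · rintro _ ⟨x, y, rfl⟩
      simp [rbRel, evalAlg_mono, evalWord_br, evalWord_mul, hQ (evalWord Q f x)]
      abel
    · intro a b hb
      simp_all
    · intro a ha b
      simp_all
    · intro a ha
      simp_all [evalAlg_brAlg]
  simpa using hle hg

/-- A homomorphism of operated algebras out of `k𝔖(X)` is determined by its values on letters. -/
theorem eq_evalAlg (g : WordAlg k X →ₙₐ[k] A) (hop : ∀ y, g (brAlg k X y) = Q (g y))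
    (hf : ∀ x, g (mono k (letter x)) = f x) (y : WordAlg k X) : g y = evalAlg Q f y := by
  have h : (g : WordAlg k X →ₗ[k] A) = (evalAlg Q f : WordAlg k X →ₗ[k] A) := by
    refine linearMap_ext fun w => ?_
    change g (mono k w) = evalAlg Q f (mono k w)
    induction w using word_induction with
    | hletter x => rw [hf, evalAlg_mono, evalWord_letter]
    | hbr w ih => rw [← brAlg_mono, hop, ih, evalAlg_brAlg]
    | hmul v w ihv ihw => rw [← mono_mul_mono, map_mul, map_mul, ihv, ihw]
  exact LinearMap.congr_fun h y

end EvalAlg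

/-! ### The free Rota–Baxter algebra -/

/-- The relations give the identity on classes of words, and bilinearity extends it. -/
theorem isRotaBaxter_op (c : k) :
    IsRotaBaxter c (OpQuot.op (brAlg k X) (Srbr X c)) := by
  have hs : Submodule.span k (Set.range fun w : Word X =>
      OpQuot.mk (brAlg k X) (Srbr X c) (mono k w)) = ⊤ := by
    rw [show (fun w : Word X => OpQuot.mk (brAlg k X) (Srbr X c) (mono k w))
        = OpQuot.mk (brAlg k X) (Srbr X c) ∘ mono k from rfl, Set.range_comp,
      Submodule.span_image, span_mono, Submodule.map_top, Submodule.range_mkQ]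
  intro x y
  refine rotaBaxterAt_of_span_left hs (Set.forall_mem_range.2 fun v => ?_) x
  refine rotaBaxterAt_of_span_right hs (Set.forall_mem_range.2 fun w => ?_) y
  have h : OpQuot.mk (brAlg k X) (Srbr X c) (rbRel c v w) = 0 :=
    (Submodule.Quotient.mk_eq_zero _).2 (subset_opIdeal _ _ ⟨v, w, rfl⟩)
  have hop : ∀ z, OpQuot.op (brAlg k X) (Srbr X c) (OpQuot.mk (brAlg k X) (Srbr X c) z)
      = OpQuot.mk (brAlg k X) (Srbr X c) (brAlg k X z) := fun z => rfl
  rw [RotaBaxterAt]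
  simp only [hop, ← OpQuot.mk_mul, brAlg_mono, mono_mul_mono]
  rw [rbRel, map_sub, map_add, map_add, map_smul, sub_eq_zero] at h
  rw [← h]
  abel

theorem isFreeRotaBaxter_opQuot (c : k) :
    IsFreeRotaBaxter.{w} c (OpQuot.op (brAlg k X) (Srbr X c))
      (fun x : X => OpQuot.mk (brAlg k X) (Srbr X c) (mono k (letter x))) := by
  refine ⟨isRotaBaxter_op c, fun A _ _ _ _ Q hQ f => ?_⟩
  let g₀ : OpQuot (brAlg k X) (Srbr X c) →ₗ[k] A :=
    (opIdeal (brAlg k X) (Srbr X c)).liftQ (evalAlg Q f : WordAlg k X →ₗ[k] A)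
      fun a ha => evalAlg_eq_zero Q f hQ ha
  have hg₀ : ∀ a, g₀ (OpQuot.mk _ _ a) = evalAlg Q f a := fun a => rfl
  have surj := (opIdeal (brAlg k X) (Srbr X c)).mkQ_surjective
  let g : OpQuot (brAlg k X) (Srbr X c) →ₙₐ[k] A :=
    { g₀ with
      map_zero' := map_zero g₀
      map_mul' := fun a b => by
        obtain ⟨a, rfl⟩ := surj a
        obtain ⟨b, rfl⟩ := surj b
        exact map_mul (evalAlg Q f) a b }
  have hg : ∀ a, g (OpQuot.mk _ _ a) = evalAlg Q f a := fun a => rfl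
  refine ⟨g, ⟨fun y => ?_, fun x => ?_⟩, ?_⟩
  · obtain ⟨y, rfl⟩ := surj y
    exact evalAlg_brAlg Q f y
  · rw [hg, evalAlg_mono, evalWord_letter]
  · rintro h ⟨hop, hf⟩
    ext y
    obtain ⟨y, rfl⟩ := surj y
    rw [hg]
    -- Composing with the projection reduces uniqueness to `k𝔖(X)`, where `eq_evalAlg` applies.
    let π : WordAlg k X →ₙₐ[k] OpQuot (brAlg k X) (Srbr X c) :=
      { OpQuot.mk (brAlg k X) (Srbr X c) with
        map_zero' := rfl
        map_mul' := fun a b => rfl }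
    exact eq_evalAlg Q f (h.comp π) (fun y => hop (OpQuot.mk _ _ y)) hf y

/-! ### Irreducible words are linearly independent modulo the ideal -/

variable (k X) in
/-- The span of the irreducible words. -/
noncomputable def irrSpan : Submodule k (WordAlg k X) := Submodule.span k (mono k '' Irr X)

/-- If `⌊w⌋` is irreducible, then `w` is not of the form `a⌊y⌋` at all, hence is tame, and the
operator acts on it as the bracket. -/
theorem evalWord_rbOp_of_mem_Irr (c : k) {w : Word X} (hw : w ∈ Irr X) :
    evalWord (rbOp X c) (fun x => mono k (letter x)) w = mono k w := by
  induction w using word_induction with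
  | hletter x => rw [evalWord_letter]
  | hbr w ih =>
    rw [evalWord_br, ih (mem_Irr_of_br hw), rbOp_mono, rbWord_of_tame]
    exact (tame_iff w).2 fun a y h => (ne_mul_br_of_br_mem_Irr hw a y h).elim
  | hmul v w ihv ihw =>
    rw [evalWord_mul, ihv (mem_Irr_of_mul_left hw), ihw (mem_Irr_of_mul_right hw), mono_mul_mono]

theorem eq_zero_of_mem_irrSpan_of_mem_opIdeal (c : k) {f : WordAlg k X} (hf : f ∈ irrSpan k X)
    (hf' : f ∈ opIdeal (brAlg k X) (Srbr X c)) : f = 0 := by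
  -- The zero on the right becomes the evaluation of `f`; what remains is that evaluation fixes the
  -- span of the irreducible words.
  rw [← evalAlg_eq_zero (rbOp X c) (fun x => mono k (letter x)) (isRotaBaxter_rbOp c) hf']
  clear hf'
  induction hf using Submodule.span_induction with
  | mem f hf =>
    obtain ⟨w, hw, rfl⟩ := hf
    rw [evalAlg_mono, evalWord_rbOp_of_mem_Irr c hw]
  | zero => simp
  | add f g _ _ hf hg => rw [map_add, ← hf, ← hg]
  | smul r f _ hf => rw [map_smul, ← hf]

end Universal

/-! ### Leading monomials and reduction -/

section Reduction
variable {k : Type*} [CommRing k] {X : Type*} [LinearOrder X]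

variable (k) in
/-- The combinations of monomials strictly below `w`. -/
noncomputable def below (w : Word X) : Submodule k (WordAlg k X) :=
  Submodule.span k (mono k '' {u | Strict plr u w})

theorem not_strict_plr_self (w : Word X) : ¬ Strict plr w w := fun h => h.2 h.1

theorem coeff_eq_zero_of_mem_below {w : Word X} {r : WordAlg k X} (hr : r ∈ below k w) :
    r.coeff w = 0 := by
  by_contra h
  exact not_strict_plr_self w (mem_span_mono_iff.1 hr w (by simpa using h))

theorem isLeading_of_sub_mem_below [Nontrivial k] {f : WordAlg k X} {w : Word X}
    (h : f - mono k w ∈ below k w) : IsLeading plr f w ∧ f.coeff w = 1 := by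
  have hc : f.coeff w = 1 := by
    have := coeff_eq_zero_of_mem_below h
    rwa [MonoidAlgebra.coeff_sub, Finsupp.sub_apply, coeff_mono_self, sub_eq_zero] at this
  refine ⟨⟨by simp [hc], fun u hu huw => ?_⟩, hc⟩
  refine mem_span_mono_iff.1 h u ?_
  simpa [mono, Finsupp.single_apply, Ne.symm huw] using hu

theorem IsLeading.unique {f : WordAlg k X} {v w : Word X} (hv : IsLeading plr f v)
    (hw : IsLeading plr f w) : v = w := by
  by_contra h
  exact (hw.2 v hv.1 h).2 (hv.2 w hw.1 (Ne.symm h)).1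

/-- The other three monomials are dominated by `⌊x⌊y⌋⌋`, hence stay below it in every context. -/
theorem linExt_rbRel_sub_mem_below (c : k) {φ : Word X → Word X} (hφ : IsContext φ)
    (x y : Word X) :
    linExt φ (rbRel c x y) - mono k (φ (br (x * br y))) ∈ below k (φ (br (x * br y))) := by
  have hm : ∀ v, Dominated v (br (x * br y)) → mono k (φ v) ∈ below k (φ (br (x * br y))) :=
    fun v hv => Submodule.subset_span ⟨_, (hv.context hφ).strict_plr, rfl⟩
  have e : linExt φ (rbRel c x y) - mono k (φ (br (x * br y))) =
      mono k (φ (br (br x * y))) + c • mono k (φ (br (x * y))) - mono k (φ (br x * br y)) := by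
    simp only [rbRel, map_sub, map_add, map_smul, linExt_mono]
    abel
  rw [e]
  exact sub_mem (add_mem (hm _ (dominated_br_br_mul x y))
    (Submodule.smul_mem _ _ (hm _ (dominated_br_mul x y)))) (hm _ (dominated_br_mul_br x y))

theorem isLeading_plugAlg_rbRel [Nontrivial k] (c : k) (q : StarWord X) (x y : Word X) :
    IsLeading plr (q.plugAlg (rbRel c x y)) (q.plug (br (x * br y))) :=
  (isLeading_of_sub_mem_below (linExt_rbRel_sub_mem_below c q.isContext x y)).1

theorem rbRel_sub_mem_below (c : k) (x y : Word X) :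
    rbRel c x y - mono k (br (x * br y)) ∈ below k (br (x * br y)) := by
  have h : linExt (k := k) (fun u : Word X => u) = LinearMap.id :=
    linearMap_ext fun w => by simp [linExt_mono]
  simpa [h] using linExt_rbRel_sub_mem_below c .id x y

theorem isLeading_rbRel [Nontrivial k] (c : k) (x y : Word X) :
    IsLeading plr (rbRel c x y) (br (x * br y)) :=
  (isLeading_of_sub_mem_below (rbRel_sub_mem_below c x y)).1

/-- Modulo a submodule containing the relations in contexts with leading monomial in a lower set
`D`, every word of `D` is a combination of irreducible words. -/
theorem mono_mem_sup_irrSpan [WellFoundedLT X] (c : k) {J : Submodule k (WordAlg k X)}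
    {D : Set (Word X)} (hD : ∀ v w, Strict plr v w → w ∈ D → v ∈ D)
    (hJ : ∀ (q : StarWord X) (x y : Word X), q.plug (br (x * br y)) ∈ D →
      q.plugAlg (rbRel c x y) ∈ J) {w : Word X} (hw : w ∈ D) :
    mono k w ∈ J ⊔ irrSpan k X := by
  induction w using (wellFounded_strict_plr (X := X)).induction with
  | _ w ih =>
    by_cases hi : w ∈ Irr X
    · exact Submodule.mem_sup_right (Submodule.subset_span ⟨w, hi, rfl⟩)
    · obtain ⟨q, x, y, rfl⟩ := not_not.1 hi
      have h1 := linExt_rbRel_sub_mem_below c q.isContext x y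
      have h2 : below k (q.plug (br (x * br y))) ≤ J ⊔ irrSpan k X := by
        refine Submodule.span_le.2 ?_
        rintro _ ⟨u, hu, rfl⟩
        exact ih u hu (hD _ _ hu hw)
      have h3 := sub_mem (Submodule.mem_sup_left (T := irrSpan k X) (hJ q x y hw)) (h2 h1)
      simpa [StarWord.plugAlg] using h3

theorem opIdeal_sup_irrSpan [WellFoundedLT X] (c : k) :
    opIdeal (brAlg k X) (Srbr X c) ⊔ irrSpan k X = ⊤ := by
  refine top_le_iff.1 (span_mono.ge.trans (Submodule.span_le.2 ?_))
  rintro _ ⟨w, rfl⟩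
  exact mono_mem_sup_irrSpan c (D := Set.univ) (fun _ _ _ _ => trivial)
    (fun q x y _ => plugAlg_mem_opIdeal c q ⟨x, y, rfl⟩) trivial

/-- An element of the ideal all of whose monomials are below `w` is trivial modulo `w`. -/
theorem isTrivialMod_of_mem_opIdeal [Nontrivial k] [WellFoundedLT X] (c : k) {w : Word X}
    {f : WordAlg k X} (hf : f ∈ opIdeal (brAlg k X) (Srbr X c)) (hw : f ∈ below k w) :
    IsTrivialMod plr (Srbr X c) w f := by
  unfold IsTrivialMod
  set J := Submodule.span k {t : WordAlg k X | ∃ q : StarWord X, ∃ s ∈ Srbr X c,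
    t = q.plugAlg s ∧ ∃ m, IsLeading plr t m ∧ Strict plr m w} with hJ
  have hle : J ≤ opIdeal (brAlg k X) (Srbr X c) := by
    refine Submodule.span_le.2 ?_
    rintro _ ⟨q, s, hs, rfl, -⟩
    exact plugAlg_mem_opIdeal c q hs
  have hb : below k w ≤ J ⊔ irrSpan k X := by
    refine Submodule.span_le.2 ?_
    rintro _ ⟨u, hu, rfl⟩
    refine mono_mem_sup_irrSpan c (D := {u | Strict plr u w})
      (fun _ _ h h' => strict_plr_trans h h') (fun q x y h => ?_) hu
    exact Submodule.subset_span
      ⟨q, _, ⟨x, y, rfl⟩, rfl, _, isLeading_plugAlg_rbRel c q x y, h⟩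
  obtain ⟨g, hg, r, hr, rfl⟩ := Submodule.mem_sup.1 (hb hw)
  -- The irreducible remainder `r` is `f` minus an element of the ideal, so it lies in the ideal.
  have : r = 0 := eq_zero_of_mem_irrSpan_of_mem_opIdeal c hr (by
    simpa using sub_mem hf (hle hg))
  rw [this, add_zero]
  exact hg

theorem isGroebnerShirshov_Srbr [Nontrivial k] [WellFoundedLT X] (c : k) :
    IsGroebnerShirshov plr (Srbr X c) where
  monic := by
    rintro _ ⟨x, y, rfl⟩
    exact ⟨_, isLeading_of_sub_mem_below (rbRel_sub_mem_below c x y)⟩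
  intersection := by
    rintro _ ⟨x, y, rfl⟩ _ ⟨x', y', rfl⟩ mf mg u v w hmf hmg hw - h1 h2
    rw [hmf.unique (isLeading_rbRel c x y), hmg.unique (isLeading_rbRel c x' y')] at h1 h2
    -- Both leading monomials are brackets, so the breadth of `w` would lie strictly between 1 and
    -- 2.
    simp only [breadth, br, FreeSemigroup.length_of] at h1 h2
    lia
  including := by
    rintro _ ⟨x, y, rfl⟩ _ ⟨x', y', rfl⟩ mf mg w q hmf hmg hw hw'
    rw [hmf.unique (isLeading_rbRel c x y)] at hw
    rw [hmg.unique (isLeading_rbRel c x' y')] at hw'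
    refine isTrivialMod_of_mem_opIdeal c (sub_mem (subset_opIdeal _ _ ⟨x, y, rfl⟩)
      (plugAlg_mem_opIdeal c q ⟨x', y', rfl⟩)) ?_
    -- Both `f` and `q|_g` equal `w` plus terms below `w`, so `w` cancels in the composition.
    have h1 := rbRel_sub_mem_below c x y
    have h2 := linExt_rbRel_sub_mem_below c q.isContext x' y'
    rw [← hw] at h1
    rw [← hw'] at h2
    simpa [StarWord.plugAlg] using sub_mem h1 h2

/-- The images of the irreducible words form a basis of the quotient. -/
theorem exists_basis_opQuot [WellFoundedLT X] (c : k) :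
    ∃ b : Module.Basis (Irr X) k (OpQuot (brAlg k X) (Srbr X c)),
      ∀ t : Irr X, b t = OpQuot.mk (brAlg k X) (Srbr X c) (mono k t.1) := by
  have hli₀ : LinearIndependent k fun t : Irr X => mono k t.1 := by
    have h := (MonoidAlgebra.basis (Word X) k).linearIndependent.comp
      (Subtype.val : Irr X → Word X) Subtype.val_injective
    convert h using 1
    funext t
    simp [mono]
  have hr : Set.range (fun t : Irr X => mono k t.1) = mono k '' Irr X := by
    ext; simp
  have hli : LinearIndependent k
      fun t : Irr X => OpQuot.mk (brAlg k X) (Srbr X c) (mono k t.1) := by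
    refine hli₀.map ?_
    rw [hr, Submodule.ker_mkQ, Submodule.disjoint_def]
    exact fun f hf hf' => eq_zero_of_mem_irrSpan_of_mem_opIdeal c hf hf'
  refine ⟨Module.Basis.mk hli ?_, fun t => Module.Basis.mk_apply _ _ t⟩
  rw [show (fun t : Irr X => OpQuot.mk (brAlg k X) (Srbr X c) (mono k t.1)) =
    OpQuot.mk (brAlg k X) (Srbr X c) ∘ fun t : Irr X => mono k t.1 from rfl, Set.range_comp,
    Submodule.span_image, hr]
  -- The ideal and the irreducible span fill `k𝔖(X)`, so the irreducible span maps onto the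
  -- quotient.
  have h := congrArg (Submodule.map (OpQuot.mk (brAlg k X) (Srbr X c))) (opIdeal_sup_irrSpan c)
  rw [Submodule.map_sup, Submodule.map_top, Submodule.range_mkQ, Submodule.mkQ_map_self,
    bot_sup_eq] at h
  exact h.ge

end Reduction

end OperatedGS

open OperatedGS in
theorem theorem4p4 {k : Type u} [CommRing k] [CharZero k] (c : k)
    {X : Type v} [LinearOrder X] [WellFoundedLT X] :
    -- the strict part of `≤_{PL_r}` has no infinite descending chains
    WellFounded (Strict (plr (X := X))) ∧
    -- leading monomials of the relations, also inside an arbitrary context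
    (∀ x y : Word X, IsLeading plr (rbRel c x y) (br (x * br y))) ∧
    (∀ (q : StarWord X) (x y : Word X),
      IsLeading plr (q.plugAlg (rbRel c x y)) (q.plug (br (x * br y)))) ∧
    -- Gröbner–Shirshov basis
    IsGroebnerShirshov plr (Srbr X c) ∧
    -- the quotient is the free nonunitary Rota–Baxter algebra of weight `c` on `X`
    IsFreeRotaBaxter.{w} c (OpQuot.op (brAlg k X) (Srbr X c))
      (fun x : X => OpQuot.mk (brAlg k X) (Srbr X c) (mono k (letter x))) ∧
    -- the irreducible words form a basis of it
    ∃ b : Module.Basis (Irr X) k (OpQuot (brAlg k X) (Srbr X c)),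
      ∀ t : Irr X, b t = OpQuot.mk (brAlg k X) (Srbr X c) (mono k t.1) :=
  ⟨wellFounded_strict_plr, isLeading_rbRel c, isLeading_plugAlg_rbRel c,
    isGroebnerShirshov_Srbr c, isFreeRotaBaxter_opQuot c, exists_basis_opQuot c⟩
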